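/- For an integer $l\ge 2$ and $n\ge 0$, let $b_l(n)$ denote the number of $l$-regular partitions of $n$, i.e. partitions of $n$ none of whose parts is divisible by $l$ (with $b_l(0)=1$). For all integers $n\ge 0$ and $k\ge 0$, $$b_{17}\left(5^{4k}n+\tfrac{2}{3}\left(5^{4k}-1\right)\right)\equiv 2^k\, b_{17}(n)\pmod{17},$$ and for every $r\in\{0,1,2,4\}$, $$b_{17}\left(5^{4k+4}n+\tfrac{1}{3}\left(5^{4k+3}(3r+1)-2\right)\right)\equiv 0\pmod{17}.$$ (Both arguments of $b_{17}$ are nonnegative integers.) -/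

import Mathlib

/-- `regularPartitionCount l n` is `b_l(n)`: the number of partitions of `n` none of whose parts
is divisible by `l`. In particular `b_l(0) = 1`, counting the empty partition. -/
def regularPartitionCount (l n : ℕ) : ℕ :=
  (Nat.Partition.restricted n (fun i => ¬ l ∣ i)).card

/-!
Write `E = ∏ (1 - Xⁱ)` for Euler's product, which Mathlib calls `pentagonalSeries`. Modulo `17` the
generating function of the `17`-regular partitions is `∏ (1 - X^(17 i)) / (1 - Xⁱ) = E ^ 16`
(`regularPartitionCount_cast`). Up to a change of variable `E ^ 16` is the weight `8` form
`η(3z)^16`, an eigenform of the square of the Hecke operator `T₅`, and the theorem expresses that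
the eigenvalue is `2 * 5 ^ 7` modulo `17`. Instead of modular forms, the proof computes with the explicit
operators `dissect r`, which keep the coefficients in one residue class modulo `5`: the whole
theorem follows by iterating
`dissect 1 (dissect 3 (dissect 1 (E ^ 16))) = 2 * X ^ 3 * E(X^5) ^ 16`
in characteristic `17` (`dissect_one_dissect_three_dissect_one_pow_sixteen`), whose right-hand side
only has exponents congruent to `3` modulo `5`.

The computation rests on the 5-dissection `E = A(X^5) - X B(X^5) + X^2 C(X^5)` with `B = E(X^5)`,
which comes from the pentagonal number theorem (`pentagonalSeries_dissection`), and on two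
relations between `A`, `B` and `C`.

* `A C = -B ^ 2` (`dissect_zero_mul_dissect_two`). Triangular numbers are never `2` modulo `5`, so by
  Jacobi's identity for `E ^ 3` (`modXPow_pentagonalSeries_pow_three`) the corresponding part of the
  cube of the dissection vanishes. Jacobi's identity is obtained by differentiating a finite form of
  the triple product.
* `B (A ^ 5 - 11 X B ^ 5 + X ^ 2 C ^ 5) = E ^ 6` (`eulerNorm_mul`), by evaluating the product of
  `E(ζ X)` over the fifth roots of unity `ζ` in two ways. This is why the coefficients are taken in
  a field of characteristic `17` that contains a primitive fifth root of unity.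

By the first relation `X ^ 4 * E` satisfies an equation of degree five over the series in `X ^ 5`
(`eulerNorm_quintic`). Newton's recursion then gives the traces of its powers, that is, one residue
class of each `E ^ m`, as polynomials in `X B` and the norm of `X ^ 4 * E`. By the second relation
these are again polynomials in `X`, `E` and `B`, up to a division by powers of `E` and `B`, so that
the operators can be applied repeatedly.
-/

open PowerSeries Finset Filter

/-! ### Euler's product as a limit of finite products -/

/-- The finite product `∏_{i=1}^n (1 - X^i)`, usually written `(q)_n` with `q = X`. -/
noncomputable def qProd (R : Type*) [CommRing R] (n : ℕ) : R⟦X⟧ :=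
  ∏ i ∈ range n, (1 - X ^ (i + 1))

section CommRing

variable {R : Type*} [CommRing R]

lemma qProd_zero : qProd R 0 = 1 := by simp [qProd]

lemma qProd_succ (n : ℕ) : qProd R (n + 1) = qProd R n * (1 - X ^ (n + 1)) := by
  simp [qProd, prod_range_succ]

lemma isUnit_qProd (n : ℕ) : IsUnit (qProd R n) := by
  simp [isUnit_iff_constantCoeff, qProd]

lemma isUnit_pentagonalSeries : IsUnit (pentagonalSeries R) := by
  have h := coeff_pentagonalSeries_pentagonal R 0
  rw [isUnit_iff_constantCoeff, ← coeff_zero_eq_constantCoeff_apply]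
  rw [show pentagonal 0 = 0 by simp [pentagonal_def]] at h
  simp [h]

/-- The quotient map to power series modulo `X ^ N`. -/
noncomputable abbrev modXPow (R : Type*) [CommRing R] (N : ℕ) :
    R⟦X⟧ →+* R⟦X⟧ ⧸ Ideal.span {(X : R⟦X⟧) ^ N} :=
  Ideal.Quotient.mk _

lemma modXPow_eq_iff {N : ℕ} {f g : R⟦X⟧} :
    modXPow R N f = modXPow R N g ↔ ∀ m < N, coeff m f = coeff m g := by
  rw [Ideal.Quotient.mk_eq_mk_iff_sub_mem, Ideal.mem_span_singleton, X_pow_dvd_iff]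
  simp [sub_eq_zero]

lemma modXPow_X_pow {N m : ℕ} (h : N ≤ m) : modXPow R N (X ^ m) = 0 := by
  rw [Ideal.Quotient.eq_zero_iff_mem, Ideal.mem_span_singleton]
  exact pow_dvd_pow _ h

lemma modXPow_qProd_eq {N m : ℕ} (h : N ≤ m) :
    modXPow R N (qProd R m) = modXPow R N (qProd R N) := by
  induction m, h using Nat.le_induction with
  | base => rfl
  | succ m hm ih => rw [qProd_succ, map_mul, ih, map_sub, modXPow_X_pow (by omega)]; simp

/-- Euler's infinite product, which is `pentagonalSeries`, agrees with its partial products up to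
any given order. -/
lemma modXPow_qProd {N m : ℕ} (h : N ≤ m) :
    modXPow R N (qProd R m) = modXPow R N (pentagonalSeries R) := by
  rw [modXPow_eq_iff]
  intro d hd
  obtain ⟨M, hM⟩ := (tendsto_finset_range.eventually
    (coeff_prod_one_sub_X_pow_eventually_eq R d)).exists_forall_of_atTop
  rw [← hM (max M m) (le_max_left _ _)]
  have h1 := modXPow_qProd_eq (R := R) h
  rw [← modXPow_qProd_eq (R := R) (h.trans (le_max_right M m)), modXPow_eq_iff] at h1
  exact h1 d hd

lemma eq_of_modXPow {f g : R⟦X⟧} (h : ∀ N, modXPow R N f = modXPow R N g) : f = g := by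
  ext d
  exact modXPow_eq_iff.mp (h (d + 1)) d (Nat.lt_succ_self d)

/-! ### Jacobi's identity -/

/-- The coefficients of the finite Jacobi triple product:
`∏_{i=1}^n (1 - y q^i) (1 - y⁻¹ q^i) * (1 - y)` is
`∑_{j = 0}^n (-1)^j (y^{-j} - y^{j+1}) * jacobiCoeff n j`, where `q = X`. Defined by the recursion
that passing from `n` to `n + 1` gives, with the convention that the value at `j = -1` equals the
one at `j = 0`. -/
noncomputable def jacobiCoeff (R : Type*) [CommRing R] : ℕ → ℕ → R⟦X⟧
  | 0, 0 => 1
  | 0, _ + 1 => 0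
  | n + 1, 0 => (1 + (X ^ (n + 1)) ^ 2 + X ^ (n + 1)) * jacobiCoeff R n 0
      + X ^ (n + 1) * jacobiCoeff R n 1
  | n + 1, j + 1 => (1 + (X ^ (n + 1)) ^ 2) * jacobiCoeff R n (j + 1)
      + X ^ (n + 1) * (jacobiCoeff R n j + jacobiCoeff R n (j + 2))

lemma jacobiCoeff_eq_zero {n j : ℕ} (h : n < j) : jacobiCoeff R n j = 0 := by
  induction n generalizing j with
  | zero =>
    obtain ⟨j, rfl⟩ := Nat.exists_eq_add_of_lt h
    simp [jacobiCoeff]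
  | succ n ih =>
    obtain ⟨j, rfl⟩ := Nat.exists_eq_succ_of_ne_zero (by omega : j ≠ 0)
    simp [jacobiCoeff, ih (show n < j + 1 by omega), ih (show n < j by omega),
      ih (show n < j + 2 by omega)]

lemma sum_jacobiCoeff_succ (n M : ℕ) :
    ∑ j ∈ range (M + 1), (-1) ^ j * (2 * j + 1) * jacobiCoeff R (n + 1) j =
      (1 - X ^ (n + 1)) ^ 2 * ∑ j ∈ range (M + 1), (-1) ^ j * (2 * j + 1) * jacobiCoeff R n j
        + X ^ (n + 1) * ((-1) ^ M * (2 * (M : R⟦X⟧) + 1) * jacobiCoeff R n (M + 1)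
          + (-1) ^ M * (2 * (M : R⟦X⟧) + 3) * jacobiCoeff R n M) := by
  induction M with
  | zero => simp [jacobiCoeff]; ring
  | succ M ih =>
    rw [sum_range_succ, ih, sum_range_succ _ (M + 1), jacobiCoeff]
    push_cast
    ring

/-- The derivative at `y = 1` of the finite Jacobi triple product. -/
lemma sum_jacobiCoeff (n : ℕ) :
    ∑ j ∈ range (n + 1), (-1) ^ j * (2 * j + 1) * jacobiCoeff R n j = qProd R n ^ 2 := by
  induction n with
  | zero => simp [jacobiCoeff, qProd_zero]
  | succ n ih =>
    rw [sum_jacobiCoeff_succ, sum_range_succ, ih, jacobiCoeff_eq_zero (show n < n + 1 by omega),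
      jacobiCoeff_eq_zero (show n < n + 1 + 1 by omega), qProd_succ]
    ring

/-- The coefficients of the finite triple product are Gaussian binomial coefficients, up to a
power of `X`. -/
lemma jacobiCoeff_mul_qProd (j m : ℕ) :
    jacobiCoeff R (j + m) j * (qProd R m * qProd R (2 * j + m + 1)) =
      X ^ (j + 1).choose 2 * qProd R (2 * (j + m) + 1) := by
  obtain ⟨n, hn⟩ : ∃ n, j + m = n := ⟨_, rfl⟩
  rw [hn]
  induction n generalizing j m with
  | zero =>
    obtain ⟨rfl, rfl⟩ : j = 0 ∧ m = 0 := by omega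
    simp [jacobiCoeff, qProd_zero]
  | succ n ih =>
    have choose_succ (j : ℕ) : (j + 1 + 1).choose 2 = (j + 1).choose 2 + (j + 1) := by
      rw [Nat.choose_succ_succ' (j + 1) 1, Nat.choose_one_right, add_comm]
    have hq : qProd R (2 * (n + 1) + 1) =
        qProd R (2 * n + 1) * ((1 - X ^ (2 * n + 2)) * (1 - X ^ (2 * n + 3))) := by
      rw [show 2 * (n + 1) + 1 = 2 * n + 1 + 1 + 1 by ring, qProd_succ, qProd_succ]
      ring
    -- The term of the recursion with the same index.
    have hA : jacobiCoeff R n j * (qProd R m * qProd R (2 * j + m + 1)) =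
        X ^ (j + 1).choose 2 * qProd R (2 * n + 1) *
          ((1 - X ^ m) * (1 - X ^ (2 * j + m + 1))) := by
      rcases m with _ | m
      · simp [jacobiCoeff_eq_zero (show n < j by omega)]
      · rw [qProd_succ m, qProd_succ (2 * j + (m + 1)), ← ih j m (by omega)]
        ring_nf
    -- The term with the next index.
    have hB : X ^ (n + 1) * (jacobiCoeff R n (j + 1) * (qProd R m * qProd R (2 * j + m + 1))) =
        X ^ (j + 1).choose 2 * qProd R (2 * n + 1) *
          ((1 - X ^ m) * (X ^ (2 * j + m + 1) - X ^ (2 * j + 2 * m))) := by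
      rcases m with _ | _ | m
      · simp [jacobiCoeff_eq_zero (show n < j + 1 by omega)]
      · simp [jacobiCoeff_eq_zero (show n < j + 1 by omega)]
      · rw [qProd_succ (m + 1), qProd_succ m]
        have := ih (j + 1) m (by omega)
        rw [choose_succ, show 2 * (j + 1) + m + 1 = 2 * j + (m + 1 + 1) + 1 by ring] at this
        rw [← hn]
        linear_combination X ^ (j + (m + 1 + 1)) * (1 - X ^ (m + 1)) * (1 - X ^ (m + 1 + 1)) * this
    rcases j with _ | j
    · obtain rfl : m = n + 1 := by omega
      rw [jacobiCoeff, hq]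
      simp only [mul_zero, zero_add] at hA hB ⊢
      linear_combination (1 + (X ^ (n + 1)) ^ 2 + X ^ (n + 1)) * hA + hB
    · have hC := ih j m (by omega)
      rw [jacobiCoeff, hq, show 2 * (j + 1) + m + 1 = 2 * j + m + 1 + 1 + 1 by ring,
        qProd_succ, qProd_succ, choose_succ]
      rw [show 2 * (j + 1) + m + 1 = 2 * j + m + 1 + 1 + 1 by ring,
        qProd_succ, qProd_succ, choose_succ] at hA hB
      obtain rfl : n = j + m := by omega
      linear_combination (1 + (X ^ (j + m + 1)) ^ 2) * hA + hB
        + X ^ (j + m + 1) * (1 - X ^ (2 * j + m + 1 + 1)) * (1 - X ^ (2 * j + m + 1 + 1 + 1)) * hC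

/-- The limit `n → ∞` of the coefficients of the triple product. -/
lemma modXPow_jacobiCoeff {N n j : ℕ} (hn : 2 * N ≤ n) (hj : j ≤ n) :
    modXPow R N (jacobiCoeff R n j) * modXPow R N (pentagonalSeries R) =
      modXPow R N (X ^ (j + 1).choose 2) := by
  obtain ⟨m, rfl⟩ := Nat.exists_eq_add_of_le hj
  have h := congrArg (modXPow R N) (jacobiCoeff_mul_qProd (R := R) j m)
  simp only [map_mul] at h
  rcases le_or_gt j N with hjN | hjN
  · rw [modXPow_qProd (by omega), modXPow_qProd (by omega), modXPow_qProd (by omega),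
      ← mul_assoc] at h
    exact (isUnit_pentagonalSeries.map (modXPow R N)).mul_right_cancel h
  · have hT : modXPow R N (X ^ (j + 1).choose 2) = 0 := by
      refine modXPow_X_pow ?_
      rw [Nat.choose_succ_succ' j 1, Nat.choose_one_right]
      omega
    rw [hT, zero_mul, ← map_mul, IsUnit.mul_left_eq_zero] at h
    · rw [hT, h, zero_mul]
    · exact ((isUnit_qProd _).mul (isUnit_qProd _)).map _

/-- **Jacobi's identity** for the cube of Euler's product: up to order `N`, it is
`∑ (-1)^j (2j+1) X^{j(j+1)/2}`. -/
theorem modXPow_pentagonalSeries_pow_three (N : ℕ) :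
    modXPow R N (pentagonalSeries R ^ 3) =
      modXPow R N (∑ j ∈ range (2 * N + 1),
        (-1) ^ j * (2 * (j : R⟦X⟧) + 1) * X ^ (j + 1).choose 2) := by
  have h := congrArg (modXPow R N) (sum_jacobiCoeff (R := R) (2 * N))
  rw [map_pow, modXPow_qProd (by omega)] at h
  rw [pow_succ, map_mul, map_pow, ← h, map_sum, map_sum, sum_mul]
  refine sum_congr rfl fun j hj => ?_
  rw [map_mul, map_mul _ _ (X ^ _), mul_assoc, modXPow_jacobiCoeff le_rfl (by simp at hj; omega)]

/-- The triangular numbers omit the residue class `2` modulo `5`. -/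
lemma coeff_pentagonalSeries_pow_three (n : ℕ) :
    coeff (5 * n + 2) (pentagonalSeries R ^ 3) = 0 := by
  rw [modXPow_eq_iff.mp (modXPow_pentagonalSeries_pow_three (5 * n + 3)) _ (by omega), map_sum]
  refine sum_eq_zero fun j _ => ?_
  have h1 : 5 * n + 2 ≠ (j + 1).choose 2 := by
    intro h
    have h2 := Nat.triangle_succ j
    have h3 : (j + 1) * j = 2 * (5 * n + 2) := by
      rw [h, Nat.choose_two_right, Nat.add_sub_cancel, Nat.mul_div_cancel']
      exact (Nat.even_mul_pred_self (j + 1)).two_dvd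
    have h4 : ((j + 1) * j) % 5 = 4 := by omega
    rw [Nat.mul_mod, Nat.add_mod] at h4
    have : j % 5 < 5 := Nat.mod_lt _ (by norm_num)
    interval_cases j % 5 <;> simp at h4
  have h2 : (-1 : R⟦X⟧) ^ j * (2 * (j : R⟦X⟧) + 1) = (((-1) ^ j * (2 * j + 1) : ℤ) : R⟦X⟧) := by
    push_cast
    ring
  rw [h2, ← map_intCast (C : R →+* R⟦X⟧), coeff_C_mul, coeff_X_pow, if_neg h1, mul_zero]

end CommRing

/-! ### Sections and the 5-dissection of Euler's product -/

/-- The substitution `f(X) ↦ f(X^5)`. -/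
noncomputable abbrev expandFive (R : Type*) [CommRing R] : R⟦X⟧ →ₐ[R] R⟦X⟧ :=
  expand 5 (by norm_num)

/-- The series whose `n`-th coefficient is the coefficient of `f` with index `5 * n + r`. -/
noncomputable def dissect {R : Type*} [CommRing R] (r : ℕ) : R⟦X⟧ →ₗ[R] R⟦X⟧ where
  toFun f := mk fun n => coeff (5 * n + r) f
  map_add' f g := by ext; simp
  map_smul' c f := by ext; simp

section CommRing

variable {R : Type*} [CommRing R]

@[simp]
lemma coeff_dissect (r n : ℕ) (f : R⟦X⟧) : coeff n (dissect r f) = coeff (5 * n + r) f := by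
  simp [dissect]

lemma expandFive_injective : Function.Injective (expandFive R) := by
  intro f g h
  ext n
  rw [← coeff_expand_mul 5 (by norm_num), ← coeff_expand_mul 5 (by norm_num) g]
  exact congrArg (coeff (5 * n)) h

lemma coeff_expandFive_mul (f g : R⟦X⟧) (n r : ℕ) (hr : r < 5) :
    coeff (5 * n + r) (expandFive R f * g) = coeff n (f * dissect r g) := by
  rw [coeff_mul, coeff_mul]
  symm
  refine sum_of_injOn (fun p => (5 * p.1, 5 * p.2 + r)) ?_ ?_ ?_ ?_
  · rintro ⟨a, b⟩ _ ⟨c, d⟩ _ h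
    simp only [Prod.mk.injEq] at h ⊢
    omega
  · rintro ⟨a, b⟩ h
    simp at h ⊢
    omega
  · rintro ⟨a, b⟩ h h'
    rw [HasAntidiagonal.mem_antidiagonal] at h
    rw [coeff_expand, if_neg, zero_mul]
    rintro ⟨k, rfl⟩
    refine h' ⟨(k, n - k), ?_, ?_⟩
    · simp
      omega
    · simp
      omega
  · rintro ⟨a, b⟩ _
    simp only [coeff_expand_mul, coeff_dissect]

/-- Series in `X^5` behave as scalars for `dissect`. -/
lemma dissect_expandFive_mul {r : ℕ} (hr : r < 5) (f g : R⟦X⟧) :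
    dissect r (expandFive R f * g) = f * dissect r g := by
  ext n
  rw [coeff_dissect, coeff_expandFive_mul f g n r hr]

lemma dissect_zero_X_pow_mul {r s : ℕ} (hs : s ≠ 0) (h : s + r = 5) (f : R⟦X⟧) :
    dissect 0 (X ^ s * f) = X * dissect r f := by
  ext n
  rcases n with _ | n
  · simp [hs]
  · rw [coeff_dissect, coeff_succ_X_mul, coeff_dissect,
      show 5 * (n + 1) + 0 = 5 * n + r + s by omega, coeff_X_pow_mul]

lemma dissect_zero_one : dissect 0 (1 : R⟦X⟧) = 1 := by
  ext n
  simp [coeff_one]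

lemma dissect_X_pow {r s : ℕ} (hr : r < 5) (hs : s < 5) :
    dissect r ((X : R⟦X⟧) ^ s) = if r = s then 1 else 0 := by
  ext n
  rw [coeff_dissect, coeff_X_pow]
  split_ifs with h1 h2 h2
  · rw [show n = 0 by omega]; simp
  · omega
  · rw [coeff_one, if_neg (by omega)]
  · simp

/-- A series decomposes into its five parts according to the residue of the exponent. -/
lemma eq_sum_dissect (f : R⟦X⟧) :
    f = ∑ r ∈ range 5, expandFive R (dissect r f) * X ^ r := by
  ext n
  obtain ⟨m, r, hr, rfl⟩ : ∃ m r, r < 5 ∧ n = 5 * m + r :=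
    ⟨n / 5, n % 5, Nat.mod_lt _ (by norm_num), by omega⟩
  rw [map_sum, sum_eq_single_of_mem r (by simpa using hr)]
  · rw [coeff_expandFive_mul _ _ _ _ hr, dissect_X_pow hr hr, if_pos rfl, mul_one, coeff_dissect]
  · intro s hs hsr
    rw [coeff_expandFive_mul _ _ _ _ hr, dissect_X_pow hr (by simpa using hs), if_neg hsr.symm,
      mul_zero, map_zero]

/-- Picking out the part with exponents divisible by `5`. -/
lemma dissect_zero_decomp (f₀ f₁ f₂ f₃ f₄ : R⟦X⟧) :
    dissect 0 (expandFive R f₀ + expandFive R f₁ * X + expandFive R f₂ * X ^ 2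
      + expandFive R f₃ * X ^ 3 + expandFive R f₄ * X ^ 4) = f₀ := by
  have h := dissect_X_pow (R := R) (r := 0) (s := 1) (by norm_num) (by norm_num)
  rw [pow_one] at h
  simp only [map_add, dissect_expandFive_mul (show 0 < 5 by norm_num), h,
    dissect_X_pow (R := R) (r := 0) (s := 2) (by norm_num) (by norm_num),
    dissect_X_pow (R := R) (r := 0) (s := 3) (by norm_num) (by norm_num),
    dissect_X_pow (R := R) (r := 0) (s := 4) (by norm_num) (by norm_num)]
  have h0 : dissect 0 (expandFive R f₀) = f₀ := by
    simpa [dissect_zero_one] using dissect_expandFive_mul (show 0 < 5 by norm_num) f₀ 1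
  simp [h0]

variable (R) in
/-- Pentagonal numbers omit the residue classes `3` and `4` modulo `5`, and those in the class
`1` are `25 * p + 1` with `p` pentagonal. -/
lemma pentagonalSeries_dissection :
    pentagonalSeries R = expandFive R (dissect 0 (pentagonalSeries R))
      - X * expandFive R (expandFive R (pentagonalSeries R))
      + X ^ 2 * expandFive R (dissect 2 (pentagonalSeries R)) := by
  have mod_five (n : ℕ) (k : ℤ) (h : pentagonal k = n) :
      (n % 5 = 0 ∨ n % 5 = 2) ∨ (n % 5 = 1 ∧ ∃ j : ℤ, k = 5 * j + 1) := by
    have h1 := two_mul_natCast_pentagonal k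
    rw [h] at h1
    obtain ⟨j, hj⟩ : ∃ j : ℤ, k = 5 * j + k % 5 := ⟨k / 5, by omega⟩
    have h2 : (0 : ℤ) ≤ k % 5 ∧ k % 5 < 5 := by omega
    obtain ⟨hk1, hk2⟩ := h2
    have h3 : (2 * n : ℤ) % 5 = ((k % 5) * (3 * (k % 5) - 1)) % 5 := by
      rw [h1, Int.mul_emod, Int.sub_emod, Int.mul_emod 3 k]
      conv_rhs => rw [Int.mul_emod, Int.sub_emod, Int.mul_emod 3]
      simp
    generalize k % 5 = t at *
    interval_cases t
    · left; omega
    · right; exact ⟨by omega, j, hj⟩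
    · left; omega
    · left; omega
    · left; omega
  have class_one : dissect 1 (pentagonalSeries R) = -expandFive R (pentagonalSeries R) := by
    ext n
    rw [coeff_dissect, map_neg, coeff_expand]
    have pent (j : ℤ) : pentagonal (5 * j + 1) = 5 * (5 * pentagonal (-j)) + 1 := by
      have h1 := two_mul_natCast_pentagonal (5 * j + 1)
      have h2 := two_mul_natCast_pentagonal_neg j
      zify
      linarith
    by_cases h : 5 * n + 1 ∈ Set.range pentagonal
    · obtain ⟨k, hk⟩ := h
      obtain ⟨_, j, rfl⟩ := (mod_five _ k hk).resolve_left (by omega)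
      obtain rfl : n = 5 * pentagonal (-j) := by have := pent j; omega
      rw [← hk, coeff_pentagonalSeries_pentagonal, if_pos (by simp),
        Nat.mul_div_cancel_left _ (by norm_num), coeff_pentagonalSeries_pentagonal,
        show 5 * j + 1 = 2 * (3 * j) + 1 + -j by ring, Int.negOnePow_add, Int.negOnePow_add,
        Int.negOnePow_two_mul]
      simp
    · rw [coeff_pentagonalSeries_eq_zero R h]
      split_ifs with h5
      · obtain ⟨m, rfl⟩ := h5
        rw [Nat.mul_div_cancel_left _ (by norm_num), coeff_pentagonalSeries_eq_zero, neg_zero]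
        rintro ⟨k, rfl⟩
        exact h ⟨5 * -k + 1, by rw [pent, neg_neg]⟩
      · simp
  have class_zero (r : ℕ) (hr : r = 3 ∨ r = 4) : dissect r (pentagonalSeries R) = 0 := by
    ext n
    rw [coeff_dissect, coeff_pentagonalSeries_eq_zero, map_zero]
    rintro ⟨k, hk⟩
    have := mod_five _ k hk
    omega
  conv_lhs => rw [eq_sum_dissect (pentagonalSeries R)]
  simp only [sum_range_succ, range_zero, sum_empty, class_one, class_zero 3 (by simp),
    class_zero 4 (by simp), map_neg, map_zero]
  ring

/-! ### The norm of Euler's product -/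

/-- The product over the fifth roots of unity of a quadratic polynomial. -/
lemma prod_quadratic_fifth_roots {S : Type*} [CommRing S] {ξ : S}
    (h : 1 + ξ + ξ ^ 2 + ξ ^ 3 + ξ ^ 4 = 0) (a y e : S) :
    ∏ i ∈ range 5, (a - ξ ^ i * y + (ξ ^ i) ^ 2 * e) =
      a ^ 5 - y ^ 5 + e ^ 5 + 5 * a * e * y ^ 3 - 5 * a ^ 2 * e ^ 2 * y := by
  have h5 : ξ ^ 5 - 1 = 0 := by linear_combination (ξ - 1) * h
  -- Group the factors of `i` and `5 - i`; `ξ + ξ⁴` and `ξ² + ξ³` are the roots of `t² + t - 1`.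
  have h14 : (a - ξ ^ 1 * y + (ξ ^ 1) ^ 2 * e) * (a - ξ ^ 4 * y + (ξ ^ 4) ^ 2 * e) =
      a ^ 2 + y ^ 2 + e ^ 2 - (ξ + ξ ^ 4) * (a * y + e * y) + (ξ ^ 2 + ξ ^ 3) * (a * e) := by
    linear_combination (y ^ 2 + a * e * ξ ^ 3 - y * e * ξ - y * e * ξ ^ 4
      + e ^ 2 * (ξ ^ 5 + 1)) * h5
  have h23 : (a - ξ ^ 2 * y + (ξ ^ 2) ^ 2 * e) * (a - ξ ^ 3 * y + (ξ ^ 3) ^ 2 * e) =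
      a ^ 2 + y ^ 2 + e ^ 2 - (ξ ^ 2 + ξ ^ 3) * (a * y + e * y) + (ξ + ξ ^ 4) * (a * e) := by
    linear_combination (y ^ 2 + a * e * ξ - y * e * ξ ^ 3 - y * e * ξ ^ 2
      + e ^ 2 * (ξ ^ 5 + 1)) * h5
  have hσ : ξ ^ 2 + ξ ^ 3 = -1 - (ξ + ξ ^ 4) := by linear_combination h
  have hρ : (ξ + ξ ^ 4) ^ 2 = 1 - (ξ + ξ ^ 4) := by
    linear_combination h + (2 + ξ ^ 3) * h5
  rw [hσ] at h14 h23
  generalize ξ + ξ ^ 4 = ρ at *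
  have : ∏ i ∈ range 5, (a - ξ ^ i * y + (ξ ^ i) ^ 2 * e) =
      (a - y + e) * ((a - ξ ^ 1 * y + (ξ ^ 1) ^ 2 * e) * (a - ξ ^ 4 * y + (ξ ^ 4) ^ 2 * e)) *
        ((a - ξ ^ 2 * y + (ξ ^ 2) ^ 2 * e) * (a - ξ ^ 3 * y + (ξ ^ 3) ^ 2 * e)) := by
    simp only [prod_range_succ, range_zero, prod_empty, pow_zero]
    ring
  rw [this, h14, h23]
  linear_combination (-(a - y + e) * (a * y + e * y + a * e) ^ 2) * hρ

end CommRing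

section Norm

variable {K : Type*} [Field K] {ζ : K}

lemma modXPow_rescale {N : ℕ} {f g : K⟦X⟧} (h : modXPow K N f = modXPow K N g) (c : K) :
    modXPow K N (rescale c f) = modXPow K N (rescale c g) := by
  rw [modXPow_eq_iff] at *
  intro m hm
  rw [coeff_rescale, coeff_rescale, h m hm]

lemma modXPow_expandFive {N : ℕ} {f g : K⟦X⟧} (h : modXPow K N f = modXPow K N g) :
    modXPow K N (expandFive K f) = modXPow K N (expandFive K g) := by
  rw [modXPow_eq_iff] at *
  intro m hm
  rw [coeff_expand, coeff_expand]
  split_ifs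
  · exact h _ (lt_of_le_of_lt (Nat.div_le_self _ _) hm)
  · rfl

lemma rescale_expandFive {c : K} (h : c ^ 5 = 1) (f : K⟦X⟧) :
    rescale c (expandFive K f) = expandFive K f := by
  ext n
  rw [coeff_rescale, coeff_expand]
  split_ifs with h5
  · obtain ⟨m, rfl⟩ := h5
    rw [pow_mul, h, one_pow, one_mul]
  · simp

lemma sum_pow_primitiveRoot {ξ : K} (hξ : IsPrimitiveRoot ξ 5) :
    1 + (C ξ : K⟦X⟧) + C ξ ^ 2 + C ξ ^ 3 + C ξ ^ 4 = 0 := by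
  have h := hξ.geom_sum_eq_zero (by norm_num)
  simp only [sum_range_succ, range_zero, sum_empty, pow_zero, pow_one, zero_add] at h
  simpa using congrArg (C : K →+* K⟦X⟧) h

lemma prod_rescale_one_sub_X_pow (hζ : IsPrimitiveRoot ζ 5) {n : ℕ} (hn : ¬ 5 ∣ n) :
    ∏ i ∈ range 5, rescale (ζ ^ i) (1 - X ^ n : K⟦X⟧) = 1 - X ^ (5 * n) := by
  have hξ : IsPrimitiveRoot (ζ ^ n) 5 :=
    hζ.pow_of_coprime n ((Nat.Prime.coprime_iff_not_dvd (by norm_num)).mpr hn).symm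
  have h := prod_quadratic_fifth_roots (sum_pow_primitiveRoot hξ) 1 (X ^ n) 0
  convert h using 1
  · refine prod_congr rfl fun i _ => ?_
    simp only [map_sub, map_one, map_pow, rescale_X]
    ring
  · ring

lemma prod_rescale_one_sub_X_pow_mul (hζ : IsPrimitiveRoot ζ 5) (n : ℕ) :
    ∏ i ∈ range 5, rescale (ζ ^ i) (1 - X ^ (5 * n) : K⟦X⟧) = (1 - X ^ (5 * n)) ^ 5 := by
  have : (1 - X ^ (5 * n) : K⟦X⟧) = expandFive K (1 - X ^ n) := by
    simp [pow_mul]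
  rw [this, prod_congr rfl fun i _ => rescale_expandFive (c := ζ ^ i) ?_ _]
  · simp
  · rw [← pow_mul, mul_comm, pow_mul, hζ.pow_eq_one, one_pow]

lemma prod_rescale_qProd (hζ : IsPrimitiveRoot ζ 5) (m : ℕ) :
    (∏ i ∈ range 5, rescale (ζ ^ i) (qProd K (5 * m))) * expandFive K (expandFive K (qProd K m)) =
      expandFive K (qProd K (5 * m)) * expandFive K (qProd K m) ^ 5 := by
  induction m with
  | zero => simp [qProd_zero]
  | succ m ih =>
    have h (n : ℕ) : ∏ i ∈ range 5, rescale (ζ ^ i) (qProd K (n + 1)) =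
        (∏ i ∈ range 5, rescale (ζ ^ i) (qProd K n)) *
          ∏ i ∈ range 5, rescale (ζ ^ i) (1 - X ^ (n + 1) : K⟦X⟧) := by
      rw [← prod_mul_distrib]
      exact prod_congr rfl fun i _ => by rw [qProd_succ, map_mul]
    rw [show 5 * (m + 1) = 5 * m + 1 + 1 + 1 + 1 + 1 by ring, h, h, h, h, h,
      prod_rescale_one_sub_X_pow hζ (n := 5 * m + 1) (by omega),
      prod_rescale_one_sub_X_pow hζ (n := 5 * m + 1 + 1) (by omega),
      prod_rescale_one_sub_X_pow hζ (n := 5 * m + 1 + 1 + 1) (by omega),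
      prod_rescale_one_sub_X_pow hζ (n := 5 * m + 1 + 1 + 1 + 1) (by omega),
      show 5 * m + 1 + 1 + 1 + 1 + 1 = 5 * (m + 1) by ring, prod_rescale_one_sub_X_pow_mul hζ,
      show 5 * (m + 1) = 5 * m + 1 + 1 + 1 + 1 + 1 by ring]
    simp only [qProd_succ, map_mul, map_sub, map_one, map_pow, expand_X]
    linear_combination ((1 - (X : K⟦X⟧) ^ (5 * (5 * m + 1))) * (1 - X ^ (5 * (5 * m + 1 + 1)))
      * (1 - X ^ (5 * (5 * m + 1 + 1 + 1))) * (1 - X ^ (5 * (5 * m + 1 + 1 + 1 + 1)))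
      * (1 - X ^ (5 * m + 1 + 1 + 1 + 1 + 1)) ^ 5 * (1 - ((X ^ 5) ^ 5) ^ (m + 1))) * ih

/-- The norm of Euler's product `E(X)` down to the series in `X^5` is `E(X^5)^6 / E(X^25)`. -/
lemma prod_rescale_pentagonalSeries (hζ : IsPrimitiveRoot ζ 5) :
    (∏ i ∈ range 5, rescale (ζ ^ i) (pentagonalSeries K)) *
        expandFive K (expandFive K (pentagonalSeries K)) =
      expandFive K (pentagonalSeries K) ^ 6 := by
  refine eq_of_modXPow fun N => ?_
  have h5 : modXPow K N (qProd K (5 * N)) = modXPow K N (pentagonalSeries K) :=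
    modXPow_qProd (by omega)
  have h1 : modXPow K N (qProd K N) = modXPow K N (pentagonalSeries K) := modXPow_qProd le_rfl
  have h := congrArg (modXPow K N) (prod_rescale_qProd hζ N)
  rw [map_mul, map_mul, map_prod, map_pow, modXPow_expandFive (modXPow_expandFive h1),
    modXPow_expandFive h1, modXPow_expandFive h5, prod_congr rfl fun i _ => modXPow_rescale h5 _]
    at h
  rw [map_mul, map_prod, h, map_pow]
  ring

end Norm

/-! ### Traces of the powers of Euler's product -/

section Quintic

variable (K : Type*) [Field K]

/-- The norm of Euler's product, up to a power of `X`: with `E(X) = A(X^5) - X B(X^5) + X^2 C(X^5)`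
the 5-dissection of Euler's product, it is `X^4 (A^5 - 11 X B^5 + X^2 C^5)`. -/
noncomputable def eulerNorm : K⟦X⟧ :=
  X ^ 4 * (dissect 0 (pentagonalSeries K) ^ 5 - 11 * X * expandFive K (pentagonalSeries K) ^ 5
    + X ^ 2 * dissect 2 (pentagonalSeries K) ^ 5)

/-- The fifth part of the trace of the `n`-th power of `X^4 E(X)`, from the series in `X` down to
the series in `X^5`. The factor `X^4` is chosen to move the middle term `-X B(X^5)` of the
5-dissection of `E` to an exponent divisible by `5`. -/
noncomputable def eulerTrace (n : ℕ) : K⟦X⟧ :=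
  dissect 0 ((X ^ 4 * pentagonalSeries K) ^ n)

variable {K}

/-- The vanishing of the coefficients of `E ^ 3` with index `≡ 2` modulo `5` relates the three
parts of the 5-dissection of `E`. -/
lemma dissect_zero_mul_dissect_two (h3 : (3 : K) ≠ 0) :
    dissect 0 (pentagonalSeries K) * dissect 2 (pentagonalSeries K) =
      -expandFive K (pentagonalSeries K) ^ 2 := by
  have hcube : dissect 0 (X ^ 3 * pentagonalSeries K ^ 3) = 0 := by
    rw [dissect_zero_X_pow_mul (r := 2) (by norm_num) (by norm_num)]
    convert mul_zero (X : K⟦X⟧)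
    ext n
    rw [coeff_dissect, coeff_pentagonalSeries_pow_three, map_zero]
  have hA : dissect 0 (pentagonalSeries K) ≠ 0 := by
    intro h
    have h0 := coeff_pentagonalSeries_pentagonal K 0
    rw [show pentagonal 0 = 5 * 0 + 0 by simp [pentagonal_def], ← coeff_dissect, h] at h0
    simp at h0
  rw [pentagonalSeries_dissection K] at hcube
  generalize dissect 0 (pentagonalSeries K) = A at *
  generalize dissect 2 (pentagonalSeries K) = D at *
  generalize expandFive K (pentagonalSeries K) = B at *
  have h := dissect_zero_decomp (X * (3 * A ^ 2 * D + 3 * A * B ^ 2))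
    (-(X * (B ^ 3 + 6 * A * B * D))) (X * (3 * B ^ 2 * D + 3 * A * D ^ 2))
    (A ^ 3 - 3 * X * B * D ^ 2) (-3 * A ^ 2 * B + X * D ^ 3)
  have h' : X * A * (3 * (A * D + B ^ 2)) = 0 := by
    rw [← hcube]
    refine Eq.trans (by ring) (h.symm.trans (congrArg (dissect 0) ?_))
    simp only [map_mul, map_add, map_sub, map_neg, map_pow, expand_X, map_ofNat]
    ring
  have h3' : (3 : K⟦X⟧) ≠ 0 := by
    rw [← map_ofNat (C : K →+* K⟦X⟧)]
    exact (map_ne_zero_iff _ C_injective).mpr h3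
  have := (mul_eq_zero.mp ((mul_eq_zero.mp h').resolve_left (mul_ne_zero X_ne_zero hA))).resolve_left
    h3'
  linear_combination this

/-- The equation of degree five that `X^4 E(X)` satisfies over the series in `X^5`. -/
lemma eulerNorm_quintic (h3 : (3 : K) ≠ 0) {w z : K⟦X⟧} (hw : w = X ^ 4 * pentagonalSeries K)
    (hz : z = X * expandFive K (pentagonalSeries K)) :
    w ^ 5 + expandFive K (5 * z) * w ^ 4 + expandFive K (15 * z ^ 2) * w ^ 3
      + expandFive K (25 * z ^ 3) * w ^ 2 + expandFive K (25 * z ^ 4) * w =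
      expandFive K (eulerNorm K) := by
  have hac := congrArg (expandFive K) (dissect_zero_mul_dissect_two h3)
  rw [pentagonalSeries_dissection K] at hw
  rw [hw, hz, eulerNorm]
  simp only [map_mul, map_add, map_sub, map_neg, map_pow, expand_X, map_ofNat] at hac ⊢
  generalize expandFive K (dissect 0 (pentagonalSeries K)) = a at *
  generalize expandFive K (dissect 2 (pentagonalSeries K)) = c at *
  generalize expandFive K (expandFive K (pentagonalSeries K)) = b at *
  -- With `s = a + X² c`, the sum `a⁵ + X¹⁰ c⁵` is a polynomial in `s` and the product `a c`.
  linear_combination X ^ 22 * (5 * (a + X ^ 2 * c) ^ 3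
    - 5 * X ^ 2 * (a * c - b ^ 2) * (a + X ^ 2 * c)) * hac

lemma eulerNorm_mul (h3 : (3 : K) ≠ 0) {ζ : K} (hζ : IsPrimitiveRoot ζ 5) :
    eulerNorm K * expandFive K (pentagonalSeries K) = X ^ 4 * pentagonalSeries K ^ 6 := by
  have hac := congrArg (expandFive K) (dissect_zero_mul_dissect_two h3)
  have h := prod_rescale_pentagonalSeries hζ
  have hfac (i : ℕ) : rescale (ζ ^ i) (pentagonalSeries K) =
      expandFive K (dissect 0 (pentagonalSeries K))
        - (C ζ) ^ i * (X * expandFive K (expandFive K (pentagonalSeries K)))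
        + ((C ζ) ^ i) ^ 2 * (X ^ 2 * expandFive K (dissect 2 (pentagonalSeries K))) := by
    have h1 : (ζ ^ i) ^ 5 = 1 := by rw [← pow_mul, mul_comm, pow_mul, hζ.pow_eq_one, one_pow]
    conv_lhs => rw [pentagonalSeries_dissection K]
    simp only [map_add, map_sub, map_mul, map_pow, rescale_X, rescale_expandFive h1]
    ring
  rw [prod_congr rfl fun i _ => hfac i, prod_quadratic_fifth_roots (sum_pow_primitiveRoot hζ)] at h
  apply expandFive_injective
  rw [eulerNorm]
  simp only [map_mul, map_add, map_sub, map_neg, map_pow, expand_X, map_ofNat] at hac ⊢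
  rw [← h]
  generalize expandFive K (dissect 0 (pentagonalSeries K)) = a at *
  generalize expandFive K (dissect 2 (pentagonalSeries K)) = c at *
  generalize expandFive K (expandFive K (pentagonalSeries K)) = b at *
  linear_combination (-5 * X ^ 25 * b ^ 4 + 5 * X ^ 25 * b ^ 2 * (a * c - b ^ 2)) * hac

/-- Newton's recursion for the traces, twisted by an arbitrary factor `g`. -/
lemma dissect_zero_pow_five_mul (h3 : (3 : K) ≠ 0) {w z : K⟦X⟧}
    (hw : w = X ^ 4 * pentagonalSeries K)
    (hz : z = X * expandFive K (pentagonalSeries K)) (g : K⟦X⟧) :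
    dissect 0 (w ^ 5 * g) = eulerNorm K * dissect 0 g - 5 * z * dissect 0 (w ^ 4 * g)
      - 15 * z ^ 2 * dissect 0 (w ^ 3 * g) - 25 * z ^ 3 * dissect 0 (w ^ 2 * g)
      - 25 * z ^ 4 * dissect 0 (w * g) := by
  have h : w ^ 5 * g = expandFive K (eulerNorm K) * g - expandFive K (5 * z) * (w ^ 4 * g)
      - expandFive K (15 * z ^ 2) * (w ^ 3 * g) - expandFive K (25 * z ^ 3) * (w ^ 2 * g)
      - expandFive K (25 * z ^ 4) * (w * g) := by
    linear_combination g * eulerNorm_quintic h3 hw hz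
  rw [h]
  simp only [map_sub, dissect_expandFive_mul (show 0 < 5 by norm_num)]

lemma eulerTrace_add_five (h3 : (3 : K) ≠ 0) {z : K⟦X⟧}
    (hz : z = X * expandFive K (pentagonalSeries K)) (n : ℕ) :
    eulerTrace K (n + 5) = eulerNorm K * eulerTrace K n - 5 * z * eulerTrace K (n + 4)
      - 15 * z ^ 2 * eulerTrace K (n + 3) - 25 * z ^ 3 * eulerTrace K (n + 2)
      - 25 * z ^ 4 * eulerTrace K (n + 1) := by
  have h := dissect_zero_pow_five_mul h3 rfl hz ((X ^ 4 * pentagonalSeries K) ^ n)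
  rw [← pow_add, ← pow_add, ← pow_add, ← pow_add, ← pow_succ'] at h
  simpa only [eulerTrace, add_comm] using h

lemma eulerTrace_zero : eulerTrace K 0 = 1 := by
  rw [eulerTrace, pow_zero, dissect_zero_one]

lemma eulerTrace_initial (h3 : (3 : K) ≠ 0) {z : K⟦X⟧}
    (hz : z = X * expandFive K (pentagonalSeries K)) :
    eulerTrace K 1 = -z ∧ eulerTrace K 2 = -z ^ 2 ∧ eulerTrace K 3 = 5 * z ^ 3 ∧
      eulerTrace K 4 = -5 * z ^ 4 := by
  have hAD := dissect_zero_mul_dissect_two h3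
  simp only [eulerTrace]
  rw [pentagonalSeries_dissection K, hz]
  generalize dissect 0 (pentagonalSeries K) = A at *
  generalize dissect 2 (pentagonalSeries K) = D at *
  generalize expandFive K (pentagonalSeries K) = B at *
  refine ⟨?_, ?_, ?_, ?_⟩
  · have h := dissect_zero_decomp (-(X * B)) (X * D) 0 0 A
    rw [← h]
    congr 1
    simp only [map_mul, map_neg, map_zero, expand_X]
    ring
  · have h := dissect_zero_decomp (X ^ 2 * (B ^ 2 + 2 * A * D)) (-2 * X ^ 2 * B * D) (X ^ 2 * D ^ 2)
      (X * A ^ 2) (-2 * X * A * B)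
    trans X ^ 2 * (B ^ 2 + 2 * A * D)
    · rw [← h]
      congr 1
      simp only [map_mul, map_add, map_neg, map_pow, expand_X, map_ofNat]
      ring
    · linear_combination 2 * X ^ 2 * hAD
  · have h := dissect_zero_decomp (-(X ^ 3 * (B ^ 3 + 6 * A * B * D)))
      (X ^ 3 * (3 * B ^ 2 * D + 3 * A * D ^ 2)) (X ^ 2 * A ^ 3 - 3 * X ^ 3 * B * D ^ 2)
      (-3 * X ^ 2 * A ^ 2 * B + X ^ 3 * D ^ 3) (X ^ 2 * (3 * A ^ 2 * D + 3 * A * B ^ 2))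
    trans -(X ^ 3 * (B ^ 3 + 6 * A * B * D))
    · rw [← h]
      congr 1
      simp only [map_mul, map_add, map_sub, map_neg, map_pow, expand_X, map_ofNat]
      ring
    · linear_combination -6 * X ^ 3 * B * hAD
  · have h := dissect_zero_decomp (X ^ 4 * (B ^ 4 + 12 * A * B ^ 2 * D + 6 * A ^ 2 * D ^ 2))
      (X ^ 3 * A ^ 4 - X ^ 4 * (4 * B ^ 3 * D + 12 * A * B * D ^ 2))
      (-4 * X ^ 3 * A ^ 3 * B + X ^ 4 * (4 * A * D ^ 3 + 6 * B ^ 2 * D ^ 2))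
      (X ^ 3 * (4 * A ^ 3 * D + 6 * A ^ 2 * B ^ 2) - 4 * X ^ 4 * B * D ^ 3)
      (-(X ^ 3 * (4 * A * B ^ 3 + 12 * A ^ 2 * B * D)) + X ^ 4 * D ^ 4)
    trans X ^ 4 * (B ^ 4 + 12 * A * B ^ 2 * D + 6 * A ^ 2 * D ^ 2)
    · rw [← h]
      congr 1
      simp only [map_mul, map_add, map_sub, map_neg, map_pow, expand_X, map_ofNat]
      ring
    · linear_combination X ^ 4 * (12 * B ^ 2 + 6 * (A * D - B ^ 2)) * hAD

lemma eulerTrace_values (h3 : (3 : K) ≠ 0) {t z : K⟦X⟧}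
    (hz : z = X * expandFive K (pentagonalSeries K)) (ht : t = eulerNorm K) :
    eulerTrace K 6 = -25 * z ^ 6 - 6 * (t * z) ∧
    eulerTrace K 10 = 2500 * z ^ 10 + 250 * t * z ^ 5 + t ^ 2 ∧
    eulerTrace K 12 = -3125 * z ^ 12 + 54 * (t * z) ^ 2 ∧
    eulerTrace K 16 = -78125 * z ^ 16 - 50000 * t * z ^ 11 - 4000 * t ^ 2 * z ^ 6
      - 16 * t ^ 3 * z ∧
    eulerTrace K 18 = -390625 * z ^ 18 - 510 * (t * z) ^ 3 := by
  have hrec := eulerTrace_add_five h3 hz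
  rw [← ht] at hrec
  have h0 := eulerTrace_zero (K := K)
  obtain ⟨h1, h2, h3, h4⟩ := eulerTrace_initial h3 hz
  have h5 : eulerTrace K 5 = t := by rw [hrec 0, h4, h3, h2, h1, h0]; ring
  have h6 : eulerTrace K 6 = -25 * z ^ 6 - 6 * t * z := by rw [hrec 1, h5, h4, h3, h2, h1]; ring
  have h7 : eulerTrace K 7 = 125 * z ^ 7 + 14 * t * z ^ 2 := by
    rw [hrec 2, h6, h5, h4, h3, h2]; ring
  have h8 : eulerTrace K 8 = -125 * z ^ 8 := by rw [hrec 3, h7, h6, h5, h4, h3]; ring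
  have h9 : eulerTrace K 9 = -625 * z ^ 9 - 90 * t * z ^ 4 := by
    rw [hrec 4, h8, h7, h6, h5, h4]; ring
  have h10 : eulerTrace K 10 = 2500 * z ^ 10 + 250 * t * z ^ 5 + t ^ 2 := by
    rw [hrec 5, h9, h8, h7, h6, h5]; ring
  have h11 : eulerTrace K 11 = -3125 * z ^ 11 - 275 * t * z ^ 6 - 11 * t ^ 2 * z := by
    rw [hrec 6, h10, h9, h8, h7, h6]; ring
  have h12 : eulerTrace K 12 = -3125 * z ^ 12 + 54 * t ^ 2 * z ^ 2 := by
    rw [hrec 7, h11, h10, h9, h8, h7]; ring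
  have h13 : eulerTrace K 13 = 15625 * z ^ 13 - 130 * t ^ 2 * z ^ 3 := by
    rw [hrec 8, h12, h11, h10, h9, h8]; ring
  have h14 : eulerTrace K 14 = -15625 * z ^ 14 := by
    rw [hrec 9, h13, h12, h11, h10, h9]; ring
  have h15 : eulerTrace K 15 = 9375 * t * z ^ 10 + 1125 * t ^ 2 * z ^ 5 + t ^ 3 := by
    rw [hrec 10, h14, h13, h12, h11, h10]; ring
  have h16 : eulerTrace K 16 = -78125 * z ^ 16 - 50000 * t * z ^ 11 - 4000 * t ^ 2 * z ^ 6
      - 16 * t ^ 3 * z := by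
    rw [hrec 11, h15, h14, h13, h12, h11]; ring
  have h17 : eulerTrace K 17 = 390625 * z ^ 17 + 106250 * t * z ^ 12 + 6375 * t ^ 2 * z ^ 7
      + 119 * t ^ 3 * z ^ 2 := by
    rw [hrec 12, h16, h15, h14, h13, h12]; ring
  have h18 : eulerTrace K 18 = -390625 * z ^ 18 - 510 * t ^ 3 * z ^ 3 := by
    rw [hrec 13, h17, h16, h15, h14, h13]; ring
  refine ⟨?_, h10, ?_, h16, ?_⟩
  · rw [h6]; ring
  · rw [h12]; ring
  · rw [h18]; ring

/-- The trace of `e ^ 2`, where `e` is the inverse of `E`. The recursion is run downwards, through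
the trace of `e`, which is Ramanujan's generating function of the partition numbers `p(5 n + 4)`. -/
lemma eulerNorm_mul_dissect_inverse (h3 : (3 : K) ≠ 0) {t z e : K⟦X⟧}
    (hz : z = X * expandFive K (pentagonalSeries K)) (ht : t = eulerNorm K)
    (he : pentagonalSeries K * e = 1) :
    t ^ 2 * dissect 0 (X ^ 2 * e ^ 2) = X ^ 2 * (10 * t * z ^ 3 + 125 * z ^ 8) := by
  obtain ⟨h1, h2, h3', h4⟩ := eulerTrace_initial h3 hz
  have hX (m n : ℕ) : dissect 0 ((X : K⟦X⟧) ^ (5 * m) * (X ^ 4 * pentagonalSeries K) ^ n) =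
      X ^ m * eulerTrace K n := by
    rw [eulerTrace, ← dissect_expandFive_mul (show 0 < 5 by norm_num), map_pow, expand_X, pow_mul]
  have hone : t * dissect 0 (X * e) = 5 * X * z ^ 4 := by
    have h := dissect_zero_pow_five_mul h3 rfl hz (X * e)
    have hs (n : ℕ) : (X ^ 4 * pentagonalSeries K) ^ (n + 1) * (X * e) =
        X ^ (5 * 1) * (X ^ 4 * pentagonalSeries K) ^ n := by
      linear_combination X ^ 5 * (X ^ 4 * pentagonalSeries K) ^ n * he
    have hs0 := hs 0
    rw [zero_add, pow_one] at hs0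
    rw [hs 4, hs 3, hs 2, hs 1, hs0, hX, hX, hX, hX, hX, eulerTrace_zero, h1, h2, h3', h4, ← ht] at h
    linear_combination -h
  have h := dissect_zero_pow_five_mul h3 rfl hz (X ^ 2 * e ^ 2)
  have hs (n : ℕ) : (X ^ 4 * pentagonalSeries K) ^ (n + 2) * (X ^ 2 * e ^ 2) =
      X ^ (5 * 2) * (X ^ 4 * pentagonalSeries K) ^ n := by
    linear_combination X ^ 10 * (X ^ 4 * pentagonalSeries K) ^ n *
      (pentagonalSeries K * e + 1) * he
  have hs1 : X ^ 4 * pentagonalSeries K * (X ^ 2 * e ^ 2) = expandFive K X * (X * e) := by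
    rw [expand_X]
    linear_combination X ^ 6 * e * he
  rw [hs 3, hs 2, hs 1, hs 0, hs1, hX, hX, hX, hX, dissect_expandFive_mul (by norm_num),
    eulerTrace_zero, h1, h2, h3', ← ht] at h
  linear_combination -t * h + 25 * z ^ 4 * X * hone

end Quintic

/-! ### The computation modulo 17 -/

section ModSeventeen

variable {K : Type*} [Field K]

lemma three_ne_zero_of_charP [CharP K 17] : (3 : K) ≠ 0 := by
  have h : ((3 : ℕ) : K) ≠ 0 := by
    rw [Ne, CharP.cast_eq_zero_iff K 17]
    norm_num
  exact_mod_cast h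

lemma seventeen_eq_zero [CharP K 17] : (17 : K⟦X⟧) = 0 := by
  have h : ((17 : ℕ) : K) = 0 := CharP.cast_eq_zero K 17
  rw [← map_ofNat (C : K →+* K⟦X⟧)]
  exact (map_eq_zero_iff _ C_injective).mpr (by exact_mod_cast h)

/-- A trace expressed through a section of `E ^ m`. -/
lemma X_pow_mul_dissect {m n i s r : ℕ} (hs : s ≠ 0) (hr : s + r = 5)
    (h : 4 * m = 5 * n + s + i) :
    X ^ (n + 1) * dissect r (X ^ i * pentagonalSeries K ^ m) = eulerTrace K m := by
  have : (X ^ 4 * pentagonalSeries K) ^ m =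
      expandFive K (X ^ n) * (X ^ s * (X ^ i * pentagonalSeries K ^ m)) := by
    rw [mul_pow, ← pow_mul, h, map_pow, expand_X, pow_add, pow_add, pow_mul]
    ring
  rw [eulerTrace, this, dissect_expandFive_mul (by norm_num), dissect_zero_X_pow_mul hs hr]
  ring

/-- The coefficients of `E ^ 16` with index `5 n + 1`, modulo `17`. The factor `B ^ 2` clears the
denominator of the term `E ^ 18 / B ^ 2`. -/
lemma dissect_one_pow_sixteen [CharP K 17] {ζ : K} (hζ : IsPrimitiveRoot ζ 5) {E B : K⟦X⟧}
    (hE : E = pentagonalSeries K) (hB : B = expandFive K (pentagonalSeries K)) :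
    B ^ 2 * dissect 1 (E ^ 16) =
      7 * X ^ 3 * B ^ 18 + 14 * X ^ 2 * E ^ 6 * B ^ 12 + 12 * X * E ^ 12 * B ^ 6 + E ^ 18 := by
  have h17 := seventeen_eq_zero (K := K)
  have h3 := three_ne_zero_of_charP (K := K)
  have hN := eulerNorm_mul h3 hζ
  obtain ⟨-, -, -, hv, -⟩ := eulerTrace_values h3 (z := X * B) (by rw [hB]) rfl
  rw [← hB, ← hE] at hN
  have h := X_pow_mul_dissect (K := K) (m := 16) (n := 12) (i := 0) (s := 4) (r := 1)
    (by norm_num) (by norm_num) (by norm_num)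
  rw [pow_zero, one_mul, ← hE, hv] at h
  generalize eulerNorm K = t at *
  refine mul_left_cancel₀ (pow_ne_zero 13 X_ne_zero) ?_
  have hB2 : X ^ 13 * (B ^ 2 * dissect 1 (E ^ 16)) = -78125 * X ^ 16 * B ^ 18
      - 50000 * X ^ 11 * B ^ 12 * (t * B) - 4000 * X ^ 6 * B ^ 6 * (t * B) ^ 2
      - 16 * X * (t * B) ^ 3 := by
    linear_combination B ^ 2 * h
  rw [hB2, hN]
  -- The multiple of `17` reduces the integer coefficients of the trace.
  linear_combination (-4596 * X ^ 16 * B ^ 18 - 2942 * X ^ 15 * B ^ 12 * E ^ 6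
    - 236 * X ^ 14 * B ^ 6 * E ^ 12 - X ^ 13 * E ^ 18) * h17

/-- The coefficients of `E ^ 16` with index `5 (5 n + 3) + 1`, modulo `17`. The factor `E ^ 2` is
`B ^ 2` in the formula for `dissect 1 (E ^ 16)`, taken out of `dissect 3`. -/
lemma dissect_three_dissect_one_pow_sixteen [CharP K 17] {ζ : K} (hζ : IsPrimitiveRoot ζ 5)
    {E B : K⟦X⟧} (hE : E = pentagonalSeries K) (hB : B = expandFive K (pentagonalSeries K)) :
    E ^ 2 * dissect 3 (dissect 1 (E ^ 16)) =
      10 * E ^ 18 + 7 * X * E ^ 12 * B ^ 6 + 2 * X ^ 2 * E ^ 6 * B ^ 12 + X ^ 3 * B ^ 18 := by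
  have h17 := seventeen_eq_zero (K := K)
  have h3 := three_ne_zero_of_charP (K := K)
  have hN := eulerNorm_mul h3 hζ
  obtain ⟨hv6, -, hv12, -, hv18⟩ := eulerTrace_values h3 (z := X * B) (by rw [hB]) rfl
  rw [← hB, ← hE] at hN
  have hN' : eulerNorm K * (X * B) = X ^ 5 * E ^ 6 := by linear_combination X * hN
  rw [hN'] at hv6 hv12 hv18
  have h := congrArg (dissect 3) (dissect_one_pow_sixteen hζ hE hB)
  have hBpow (k : ℕ) : B ^ k = expandFive K (E ^ k) := by rw [map_pow, hE, hB]
  have hsplit : 7 * X ^ 3 * B ^ 18 + 14 * X ^ 2 * E ^ 6 * B ^ 12 + 12 * X * E ^ 12 * B ^ 6 + E ^ 18 =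
      expandFive K (7 * E ^ 18) * X ^ 3 + expandFive K (14 * E ^ 12) * (X ^ 2 * E ^ 6)
        + expandFive K (12 * E ^ 6) * (X ^ 1 * E ^ 12) + X ^ 0 * E ^ 18 := by
    rw [hBpow, hBpow, hBpow]
    simp only [map_mul, map_ofNat]
    ring
  rw [hsplit, hBpow] at h
  simp only [map_add, dissect_expandFive_mul (show 3 < 5 by norm_num)] at h
  rw [dissect_X_pow (by norm_num) (by norm_num), if_pos rfl] at h
  have e6 := X_pow_mul_dissect (K := K) (m := 6) (n := 4) (i := 2) (s := 2) (r := 3)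
    (by norm_num) (by norm_num) (by norm_num)
  have e12 := X_pow_mul_dissect (K := K) (m := 12) (n := 9) (i := 1) (s := 2) (r := 3)
    (by norm_num) (by norm_num) (by norm_num)
  have e18 := X_pow_mul_dissect (K := K) (m := 18) (n := 14) (i := 0) (s := 2) (r := 3)
    (by norm_num) (by norm_num) (by norm_num)
  rw [← hE, hv6] at e6
  rw [← hE, hv12] at e12
  rw [← hE, hv18] at e18
  refine mul_left_cancel₀ (pow_ne_zero 15 X_ne_zero) ?_
  linear_combination X ^ 15 * h + 14 * X ^ 10 * E ^ 12 * e6 + 12 * X ^ 5 * E ^ 6 * e12 + e18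
    + (3 * X ^ 15 * E ^ 18 - 21 * X ^ 16 * E ^ 12 * B ^ 6 - 2206 * X ^ 17 * E ^ 6 * B ^ 12
      - 22978 * X ^ 18 * B ^ 18) * h17

/-- The preceding formula solved for the series, with `e` the inverse of `E`, as a combination
whose coefficients are series in `X^5`. -/
lemma dissect_three_dissect_one_pow_sixteen_eq [CharP K 17] {ζ : K} (hζ : IsPrimitiveRoot ζ 5)
    {E e : K⟦X⟧} (hE : E = pentagonalSeries K) (he : E * e = 1) :
    dissect 3 (dissect 1 (E ^ 16)) =
      expandFive K 10 * (X ^ 0 * E ^ 16) + expandFive K (7 * E ^ 6) * (X ^ 1 * E ^ 10)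
        + expandFive K (2 * E ^ 12) * (X ^ 2 * E ^ 4) + expandFive K (E ^ 18) * (X ^ 3 * e ^ 2) := by
  have hf := dissect_three_dissect_one_pow_sixteen hζ hE rfl
  rw [← hE] at hf
  simp only [map_mul, map_pow, map_ofNat]
  generalize dissect 3 (dissect 1 (E ^ 16)) = f at *
  generalize expandFive K E = B at *
  linear_combination e ^ 2 * hf + (E * e + 1) * (-f + 10 * E ^ 16 + 7 * X * E ^ 10 * B ^ 6
    + 2 * X ^ 2 * E ^ 4 * B ^ 12) * he

lemma dissect_one_X_pow_three_mul (g : K⟦X⟧) :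
    dissect 1 (X ^ 3 * g) = dissect 0 (X ^ 2 * g) := by
  refine mul_left_cancel₀ (X_ne_zero (R := K)) ?_
  rw [← dissect_zero_X_pow_mul (s := 4) (by norm_num) (by norm_num),
    ← dissect_expandFive_mul (by norm_num), expand_X]
  congr 1
  ring

/-- The coefficients of `E ^ 16` with index `5 (5 (5 n + 1) + 3) + 1`, modulo `17`. -/
lemma dissect_one_dissect_three_dissect_one_pow_sixteen [CharP K 17] {ζ : K}
    (hζ : IsPrimitiveRoot ζ 5) {E B : K⟦X⟧} (hE : E = pentagonalSeries K)
    (hB : B = expandFive K (pentagonalSeries K)) :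
    dissect 1 (dissect 3 (dissect 1 (E ^ 16))) = 2 * X ^ 3 * B ^ 16 := by
  have h17 := seventeen_eq_zero (K := K)
  have h3 := three_ne_zero_of_charP (K := K)
  have hN := eulerNorm_mul h3 hζ
  obtain ⟨-, hv10, -, hv16, -⟩ := eulerTrace_values h3 (z := X * B) (by rw [hB]) rfl
  obtain ⟨-, -, -, hv4⟩ := eulerTrace_initial h3 (z := X * B) (by rw [hB])
  rw [← hB, ← hE] at hN
  obtain ⟨e, he⟩ := (isUnit_pentagonalSeries (R := K)).exists_right_inv
  have hI := eulerNorm_mul_dissect_inverse h3 (z := X * B) (by rw [hB]) rfl he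
  rw [← hE] at he
  have hf' := dissect_three_dissect_one_pow_sixteen_eq hζ hE he
  have hinv := dissect_one_X_pow_three_mul (e ^ 2)
  have h := congrArg (dissect 1) hf'
  simp only [map_add, dissect_expandFive_mul (show 1 < 5 by norm_num)] at h
  rw [hinv] at h
  have e16 := X_pow_mul_dissect (K := K) (m := 16) (n := 12) (i := 0) (s := 4) (r := 1)
    (by norm_num) (by norm_num) (by norm_num)
  have e10 := X_pow_mul_dissect (K := K) (m := 10) (n := 7) (i := 1) (s := 4) (r := 1)
    (by norm_num) (by norm_num) (by norm_num)
  have e4 := X_pow_mul_dissect (K := K) (m := 4) (n := 2) (i := 2) (s := 4) (r := 1)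
    (by norm_num) (by norm_num) (by norm_num)
  rw [← hE, hv16] at e16
  rw [← hE, hv10] at e10
  rw [← hE, hv4] at e4
  have hN' : X ^ 5 * E ^ 6 = eulerNorm K * (X * B) := by linear_combination -X * hN
  generalize eulerNorm K = t at *
  rw [h]
  -- The power `X ^ 15` turns every `E ^ 6` into a product of the norm with `X B`.
  refine mul_left_cancel₀ (pow_ne_zero 15 X_ne_zero) ?_
  generalize dissect 0 (X ^ 2 * e ^ 2) = p at *
  generalize dissect 1 (X ^ 0 * E ^ 16) = q at *
  generalize dissect 1 (X ^ 1 * E ^ 10) = r at *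
  generalize dissect 1 (X ^ 2 * E ^ 4) = s at *
  have hlhs : X ^ 15 * (10 * q + 7 * E ^ 6 * r + 2 * E ^ 12 * s + E ^ 18 * p) =
      10 * X ^ 2 * (X ^ (12 + 1) * q) + 7 * X ^ 2 * (X ^ 5 * E ^ 6) * (X ^ (7 + 1) * r)
        + 2 * X ^ 2 * (X ^ 5 * E ^ 6) ^ 2 * (X ^ (2 + 1) * s) + (X ^ 5 * E ^ 6) ^ 3 * p := by
    ring
  rw [hlhs, e16, e10, e4, hN']
  linear_combination t * (X * B) ^ 3 * hI + X ^ 2 * (-9 * t ^ 3 * (X * B)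
    - 2250 * t ^ 2 * (X * B) ^ 6 - 28375 * t * (X * B) ^ 11 - 45956 * (X * B) ^ 16) * h17

lemma coeff_dissect_dissect (f : K⟦X⟧) (r n : ℕ) :
    coeff n (dissect r (dissect 1 (dissect 3 (dissect 1 f)))) =
      coeff (625 * n + 125 * r + 41) f := by
  simp only [coeff_dissect]
  congr 2
  ring

/-- The class `3` is the only one present in `2 * X ^ 3 * E(X^5) ^ 16`, where it is `2 * E ^ 16`. -/
lemma coeff_pow_sixteen_self [CharP K 17] {ζ : K} (hζ : IsPrimitiveRoot ζ 5) (n : ℕ) :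
    coeff (625 * n + 416) (pentagonalSeries K ^ 16) = 2 * coeff n (pentagonalSeries K ^ 16) := by
  have h := coeff_dissect_dissect (pentagonalSeries K ^ 16) 3 n
  have hs : 2 * X ^ 3 * expandFive K (pentagonalSeries K) ^ 16 =
      expandFive K (C 2 * pentagonalSeries K ^ 16) * X ^ 3 := by
    simp only [map_mul, map_pow, map_ofNat]
    ring
  rw [dissect_one_dissect_three_dissect_one_pow_sixteen hζ rfl rfl, hs,
    dissect_expandFive_mul (by norm_num), dissect_X_pow (by norm_num) (by norm_num), if_pos rfl,
    mul_one, coeff_C_mul] at h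
  exact h.symm

lemma coeff_pow_sixteen_eq_zero [CharP K 17] {ζ : K} (hζ : IsPrimitiveRoot ζ 5) {r : ℕ}
    (hr : r < 5) (hr3 : r ≠ 3) (n : ℕ) :
    coeff (625 * n + 125 * r + 41) (pentagonalSeries K ^ 16) = 0 := by
  have h := coeff_dissect_dissect (pentagonalSeries K ^ 16) r n
  have hs : 2 * X ^ 3 * expandFive K (pentagonalSeries K) ^ 16 =
      expandFive K (2 * pentagonalSeries K ^ 16) * X ^ 3 := by
    simp only [map_mul, map_pow, map_ofNat]
    ring
  rw [dissect_one_dissect_three_dissect_one_pow_sixteen hζ rfl rfl, hs,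
    dissect_expandFive_mul hr, dissect_X_pow hr (by norm_num), if_neg hr3, mul_zero,
    map_zero] at h
  exact h.symm

open PowerSeries.WithPiTopology in
/-- By Glaisher's theorem the `17`-regular partitions have the generating function
`∏ (1 + Xⁱ + ⋯ + X^(16 i))`, which is `∏ (1 - Xⁱ) ^ 16` in characteristic `17`. -/
lemma regularPartitionCount_cast [CharP K 17] (n : ℕ) :
    (regularPartitionCount 17 n : K) = coeff n (pentagonalSeries K ^ 16) := by
  let : TopologicalSpace K := ⊥
  have : DiscreteTopology K := ⟨rfl⟩
  have h := Nat.Partition.hasProd_powerSeriesMk_card_countRestricted K (show 0 < 17 by norm_num)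
  have : Fact (Nat.Prime 17) := ⟨by norm_num⟩
  have : CharP K⟦X⟧ 17 := charP_of_injective_ringHom (C_injective (R := K)) 17
  have hterm (i : ℕ) : ∑ j ∈ range 17, (X : K⟦X⟧) ^ ((i + 1) * j) = (1 - X ^ (i + 1)) ^ 16 := by
    have hne : (1 - X ^ (i + 1) : K⟦X⟧) ≠ 0 := fun h0 => by
      simpa using congrArg constantCoeff h0
    refine mul_right_cancel₀ hne ?_
    simp_rw [pow_mul]
    rw [geom_sum_mul_neg, ← pow_succ, sub_pow_char, one_pow]
  simp_rw [hterm] at h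
  have h' : HasProd (fun i => (1 - X ^ (i + 1) : K⟦X⟧) ^ 16) (pentagonalSeries K ^ 16) :=
    (hasProd_one_sub_X_pow K).pow 16
  rw [← h.unique h', coeff_mk, regularPartitionCount,
    Nat.Partition.card_restricted_eq_card_countRestricted n (by norm_num)]

end ModSeventeen

/-! ### Congruences for regular partitions -/

lemma exists_field_primitiveRoot :
    ∃ (K : Type) (_ : Field K) (_ : CharP K 17) (ζ : K), IsPrimitiveRoot ζ 5 := by
  have : Fact (Nat.Prime 17) := ⟨by norm_num⟩
  have hchar : CharP (AlgebraicClosure (ZMod 17)) 17 :=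
    charP_of_injective_algebraMap (algebraMap (ZMod 17) _).injective 17
  have : NeZero ((5 : ℕ) : AlgebraicClosure (ZMod 17)) := ⟨by
    rw [Ne, CharP.cast_eq_zero_iff (AlgebraicClosure (ZMod 17)) 17]
    norm_num⟩
  obtain ⟨ζ, hζ⟩ := IsAlgClosed.exists_root
    (Polynomial.cyclotomic 5 (AlgebraicClosure (ZMod 17)))
    (by rw [Polynomial.degree_cyclotomic]; decide)
  exact ⟨_, _, hchar, ζ, Polynomial.isRoot_cyclotomic_iff.mp hζ⟩

lemma regularPartitionCount_modEq_two_mul (n : ℕ) :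
    regularPartitionCount 17 (625 * n + 416) ≡ 2 * regularPartitionCount 17 n [MOD 17] := by
  obtain ⟨K, _, _, ζ, hζ⟩ := exists_field_primitiveRoot
  rw [← CharP.natCast_eq_natCast K 17, Nat.cast_mul, regularPartitionCount_cast,
    regularPartitionCount_cast, coeff_pow_sixteen_self hζ]
  norm_num

lemma regularPartitionCount_modEq_zero {r : ℕ} (hr : r < 5) (hr3 : r ≠ 3) (n : ℕ) :
    regularPartitionCount 17 (625 * n + 125 * r + 41) ≡ 0 [MOD 17] := by
  obtain ⟨K, _, _, ζ, hζ⟩ := exists_field_primitiveRoot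
  rw [← CharP.natCast_eq_natCast K 17, regularPartitionCount_cast,
    coeff_pow_sixteen_eq_zero hζ hr hr3, Nat.cast_zero]

lemma three_dvd_pow_sub_one (k : ℕ) : 3 ∣ 5 ^ (4 * k) - 1 := by
  rw [pow_mul]
  exact dvd_trans (by norm_num) (Nat.sub_one_dvd_pow_sub_one (5 ^ 4) k)

/-- The first congruence, with `5 ^ (4 * k) = 3 * m + 1`. -/
lemma regularPartitionCount_modEq_two_pow_mul (k m n : ℕ) (hm : 5 ^ (4 * k) = 3 * m + 1) :
    regularPartitionCount 17 (5 ^ (4 * k) * n + 2 * m)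
      ≡ 2 ^ k * regularPartitionCount 17 n [MOD 17] := by
  induction k generalizing m n with
  | zero =>
    obtain rfl : m = 0 := by simpa using hm.symm
    simpa using Nat.ModEq.refl _
  | succ k ih =>
    obtain ⟨m', hm'⟩ : ∃ m', 5 ^ (4 * k) = 3 * m' + 1 := by
      obtain ⟨m', h⟩ := three_dvd_pow_sub_one k
      exact ⟨m', by have := Nat.one_le_pow (4 * k) 5 (by norm_num); omega⟩
    have hpow : 5 ^ (4 * (k + 1)) = 625 * 5 ^ (4 * k) := by ring
    have hidx : 5 ^ (4 * (k + 1)) * n + 2 * m = 5 ^ (4 * k) * (625 * n + 416) + 2 * m' := by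
      have h1 : m = 208 * (3 * m' + 1) + m' := by rw [hpow, hm'] at hm; omega
      rw [hpow, h1, hm']
      ring
    rw [hidx, pow_succ, mul_assoc]
    exact (ih m' _ hm').trans ((regularPartitionCount_modEq_two_mul n).mul_left _)

theorem theorem2 (n k : ℕ) :
    (3 ∣ 2 * (5 ^ (4 * k) - 1) ∧
      regularPartitionCount 17 (5 ^ (4 * k) * n + 2 * (5 ^ (4 * k) - 1) / 3)
        ≡ 2 ^ k * regularPartitionCount 17 n [MOD 17]) ∧
    ∀ r ∈ ({0, 1, 2, 4} : Set ℕ),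
      3 ∣ 5 ^ (4 * k + 3) * (3 * r + 1) - 2 ∧
      regularPartitionCount 17
          (5 ^ (4 * k + 4) * n + (5 ^ (4 * k + 3) * (3 * r + 1) - 2) / 3)
        ≡ 0 [MOD 17] := by
  obtain ⟨m, hm'⟩ := three_dvd_pow_sub_one k
  have hm : 5 ^ (4 * k) = 3 * m + 1 := by
    have := Nat.one_le_pow (4 * k) 5 (by norm_num)
    omega
  refine ⟨⟨?_, ?_⟩, fun r hr => ?_⟩
  · exact dvd_mul_of_dvd_right ⟨m, hm'⟩ 2
  · rw [hm', show 2 * (3 * m) / 3 = 2 * m by omega]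
    exact regularPartitionCount_modEq_two_pow_mul k m n hm
  · have hr5 : r < 5 ∧ r ≠ 3 := by
      simp only [Set.mem_insert_iff, Set.mem_singleton_iff] at hr
      omega
    have hsub : 5 ^ (4 * k + 3) * (3 * r + 1) - 2 =
        3 * (5 ^ (4 * k) * (125 * r + 41) + 2 * m) := by
      rw [pow_add, hm]
      refine Nat.sub_eq_of_eq_add ?_
      ring
    have hidx : 5 ^ (4 * k + 4) * n + (5 ^ (4 * k) * (125 * r + 41) + 2 * m) =
        5 ^ (4 * k) * (625 * n + 125 * r + 41) + 2 * m := by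
      ring
    rw [hsub, Nat.mul_div_cancel_left _ (by norm_num), hidx]
    refine ⟨dvd_mul_right _ _, (regularPartitionCount_modEq_two_pow_mul k m _ hm).trans ?_⟩
    simpa using (regularPartitionCount_modEq_zero hr5.1 hr5.2 n).mul_left (2 ^ k)
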